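/- Let $X$ be a complex Banach space, let $\mathcal{B}(X)$ be the algebra of bounded linear operators on $X$, and let $T\in\mathcal{B}(X)$. For a linear map $S$ on a vector space, with kernel $N(S)$ and range $R(S)$, let the ascent $a(S)$ be the least $p\ge 0$ with $N(S^p)=N(S^{p+1})$ and the descent $d(S)$ the least $q\ge 0$ with $R(S^q)=R(S^{q+1})$ ($\infty$ if there is none). Put $$\sigma_{desc}(T)=\{\lambda\in\mathbb{C}: d(\lambda I-T)=\infty\},\qquad \sigma_{asc}(T)=\{\lambda\in\mathbb{C}: a(\lambda I-T)=\infty\},$$ $$\sigma_{desc}(T,\mathcal{B}(X))=\{\lambda\in\mathbb{C}: d(L_{T-\lambda I})=\infty\},$$ where $L_A:\mathcal{B}(X)\to\mathcal{B}(X)$, $L_A(B)=AB$, is left multiplication by $A$. Let $\sigma(T)$, $\sigma_p(T)$, $\sigma_{ap}(T)$ and $\sigma_{su}(T)=\{\lambda:\lambda I-T\text{ is not surjective}\}$ be the spectrum, the point spectrum, the approximate point spectrum and the surjectivity spectrum of $T$. An operator $S\in\mathcal{B}(X)$ is upper semi-Fredholm if $\dim N(S)<\infty$ and $R(S)$ is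 closed, and then $\mathrm{ind}(S)=\dim N(S)-\mathrm{codim}\,R(S)\in\mathbb{Z}\cup\{-\infty\}$. Let $\sigma_{ub}(T)$ (upper semi-Browder spectrum) be the set of $\lambda\in\mathbb{C}$ for which $\lambda I-T$ is not an upper semi-Fredholm operator with finite ascent, and $\sigma_{uw}(T)$ (upper semi-Weyl spectrum) the set of $\lambda\in\mathbb{C}$ for which $\lambda I-T$ is not an upper semi-Fredholm operator with $\mathrm{ind}\le 0$. Let $\mathcal{S}(T)$ be the set of points $\lambda_0\in\mathbb{C}$ at which $T$ fails the single-valued extension property (SVEP), which says: on every connected open neighbourhood $U$ of $\lambda_0$ the only analytic $f:U\to X$ with $(\lambda I-T)f(\lambda)=0$ for all $\lambda\in U$ is $f\equiv 0$. If $T$ satisfies at least one of the conditions 1. $\sigma(T)=\sigma_{su}(T)$; 2. $\operatorname{int}\sigma_{ap}(T)=\emptyset$; 3. $\operatorname{int}\sigma_{p}(T)=\emptyset$; 4. $\operatorname{int}\sigma_{asc}(T)=\emptyset$; 5. $\operatorname{int}\sigma_{ub}(T)=\emptyset$; 6. $\operatorname{int}\sigma_{uw}(T)=\emptyset$; 7.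 $\mathcal{S}(T)=\emptyset$ (that is, $T$ has the SVEP); then $\sigma_{desc}(T)=\sigma_{desc}(T,\mathcal{B}(X))$. -/

import Mathlib

noncomputable section

namespace DescentSpectrum

section Linear

variable {V : Type*} [AddCommGroup V] [Module ℂ V]

/-- The ascent `a(T)`: the least `p` with `N(T^p) = N(T^(p+1))`, and `⊤` if there is none. -/
def ascent (T : Module.End ℂ V) : ℕ∞ :=
  ⨅ (p : ℕ) (_ : LinearMap.ker (T ^ p) = LinearMap.ker (T ^ (p + 1))), (p : ℕ∞)

/-- The descent `d(T)`: the least `q` with `R(T^q) = R(T^(q+1))`, and `⊤` if there is none. -/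
def descent (T : Module.End ℂ V) : ℕ∞ :=
  ⨅ (q : ℕ) (_ : LinearMap.range (T ^ q) = LinearMap.range (T ^ (q + 1))), (q : ℕ∞)

end Linear

section Algebra

variable {A : Type*} [Ring A] [Algebra ℂ A]

/-- The descent of an element `a` of a unital complex algebra: the descent of `L_a : x ↦ a * x`. -/
def elementDescent (a : A) : ℕ∞ :=
  descent (LinearMap.mulLeft ℂ a)

/-- The descent spectrum of an element `a` of a unital complex algebra `A`. -/
def elementDescentSpectrum (a : A) : Set ℂ :=
  {l | elementDescent (a - algebraMap ℂ A l) = ⊤}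

end Algebra

section Operator

variable {X : Type*} [NormedAddCommGroup X] [NormedSpace ℂ X]

/-- The operator `λ I - T`. -/
def shift (T : X →L[ℂ] X) (l : ℂ) : X →L[ℂ] X :=
  l • ContinuousLinearMap.id ℂ X - T

/-- The descent spectrum of `T` as an operator. -/
def descentSpectrum (T : X →L[ℂ] X) : Set ℂ :=
  {l | descent (shift T l : X →ₗ[ℂ] X) = ⊤}

/-- The ascent spectrum. -/
def ascentSpectrum (T : X →L[ℂ] X) : Set ℂ :=
  {l | ascent (shift T l : X →ₗ[ℂ] X) = ⊤}

/-- The surjectivity spectrum. -/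
def surjectivitySpectrum (T : X →L[ℂ] X) : Set ℂ :=
  {l | ¬ Function.Surjective (shift T l)}

/-- The point spectrum, that is, the set of eigenvalues. -/
def pointSpectrum (T : X →L[ℂ] X) : Set ℂ :=
  {l | Module.End.HasEigenvalue (T : X →ₗ[ℂ] X) l}

/-- The approximate point spectrum. -/
def approximatePointSpectrum (T : X →L[ℂ] X) : Set ℂ :=
  {l | ∃ x : ℕ → X, (∀ n, ‖x n‖ = 1) ∧
    Filter.Tendsto (fun n => shift T l (x n)) Filter.atTop (nhds 0)}

/-- `α(T)`, the dimension of the kernel (`⊤` if infinite). -/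
def nullity (T : X →L[ℂ] X) : ℕ∞ :=
  Cardinal.toENat (Module.rank ℂ (LinearMap.ker (T : X →ₗ[ℂ] X)))

/-- `β(T)`, the codimension of the range (`⊤` if infinite). -/
def deficiency (T : X →L[ℂ] X) : ℕ∞ :=
  Cardinal.toENat (Module.rank ℂ (X ⧸ LinearMap.range (T : X →ₗ[ℂ] X)))

/-- Upper semi-Fredholm operators: finite-dimensional kernel and closed range. -/
def IsUpperSemiFredholm (T : X →L[ℂ] X) : Prop :=
  nullity T < ⊤ ∧ IsClosed (Set.range T)

/-- The index `α(T) - β(T)`, used only when at least one of the two is finite. -/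
def index (T : X →L[ℂ] X) : EReal :=
  ((nullity T : ENNReal) : EReal) - ((deficiency T : ENNReal) : EReal)

/-- Upper semi-Browder operators. -/
def IsUpperSemiBrowder (T : X →L[ℂ] X) : Prop :=
  IsUpperSemiFredholm T ∧ ascent (T : X →ₗ[ℂ] X) < ⊤

/-- Upper semi-Weyl operators. -/
def IsUpperSemiWeyl (T : X →L[ℂ] X) : Prop :=
  IsUpperSemiFredholm T ∧ index T ≤ 0

/-- The upper semi-Browder spectrum. -/
def upperSemiBrowderSpectrum (T : X →L[ℂ] X) : Set ℂ :=
  {l | ¬ IsUpperSemiBrowder (shift T l)}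

/-- The upper semi-Weyl spectrum. -/
def upperSemiWeylSpectrum (T : X →L[ℂ] X) : Set ℂ :=
  {l | ¬ IsUpperSemiWeyl (shift T l)}

/-- `T` has the single-valued extension property at `l₀`: on every connected open neighbourhood
`U` of `l₀`, the only analytic solution of `(λ I - T) f(λ) = 0` is `f = 0`. -/
def HasSVEPAt (T : X →L[ℂ] X) (l₀ : ℂ) : Prop :=
  ∀ U : Set ℂ, IsOpen U → IsConnected U → l₀ ∈ U → ∀ f : ℂ → X, AnalyticOnNhd ℂ f U →
    (∀ l ∈ U, shift T l (f l) = 0) → ∀ l ∈ U, f l = 0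

/-- `S(T)`, the set of points at which `T` does not have the SVEP. -/
def svepFailureSet (T : X →L[ℂ] X) : Set ℂ :=
  {l | ¬ HasSVEPAt T l}

/-- `T` has the single-valued extension property. -/
def HasSVEP (T : X →L[ℂ] X) : Prop :=
  svepFailureSet T = ∅

end Operator

end DescentSpectrum

end

/-! `L_a` has finite descent exactly when `a ^ q = a ^ (q + 1) * c` for some `q` and `c`, so one
inclusion is immediate. Conversely, if `S = λI - T` has finite descent and finite ascent, such a `c`
can be built, bounded by the open mapping theorem (`exists_pow_eq_pow_succ_mul`). Equality can thus
fail only at a `λ` of finite descent and infinite ascent. There, lifting through `R(S^q) =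
R(S^(q+1))` with geometric norm control yields power series showing that SVEP fails at `λ` and that
`m - T` is surjective but not injective on a nonempty open set of `m`
(`exists_open_surjective_not_injective`). Each of the seven conditions excludes this. -/

namespace DescentSpectrum

/-! ### Kernels and ranges of powers -/

section Linear

variable {V : Type*} [AddCommGroup V] [Module ℂ V]

theorem ascent_eq_top_iff (T : Module.End ℂ V) :
    ascent T = ⊤ ↔ ∀ p : ℕ, LinearMap.ker (T ^ p) ≠ LinearMap.ker (T ^ (p + 1)) := by
  simp [ascent, iInf_eq_top]

theorem descent_eq_top_iff (T : Module.End ℂ V) :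
    descent T = ⊤ ↔ ∀ q : ℕ, LinearMap.range (T ^ q) ≠ LinearMap.range (T ^ (q + 1)) := by
  simp [descent, iInf_eq_top]

theorem range_pow_constant {T : Module.End ℂ V} {q : ℕ}
    (h : LinearMap.range (T ^ q) = LinearMap.range (T ^ (q + 1))) (m : ℕ) :
    LinearMap.range (T ^ q) = LinearMap.range (T ^ (q + m)) := by
  induction m with
  | zero => rfl
  | succ m ih =>
    rw [h, ← add_assoc, pow_succ' T q, pow_succ' T (q + m), Module.End.mul_eq_comp,
      Module.End.mul_eq_comp, LinearMap.range_comp, LinearMap.range_comp, ih]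

theorem ascent_eq_top_of_surjective {T : Module.End ℂ V} (hs : Function.Surjective T) {x : V}
    (hx : x ≠ 0) (hTx : T x = 0) : ascent T = ⊤ := by
  rw [ascent_eq_top_iff]
  intro p h
  have hsp : Function.Surjective (T ^ p) := by
    rw [Module.End.coe_pow]
    exact hs.iterate p
  obtain ⟨y, rfl⟩ := hsp x
  have : y ∈ LinearMap.ker (T ^ (p + 1)) := by
    rw [LinearMap.mem_ker, pow_succ', Module.End.mul_apply, hTx]
  rw [← h, LinearMap.mem_ker] at this
  exact hx this

end Linear

/-! ### Descent of left multiplication -/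

section Algebra

variable {A : Type*} [Ring A] [Algebra ℂ A]

theorem elementDescent_eq_top_iff (a : A) :
    elementDescent a = ⊤ ↔ ∀ (q : ℕ) (c : A), a ^ q ≠ a ^ (q + 1) * c := by
  rw [elementDescent, descent_eq_top_iff]
  refine forall_congr' fun q => ?_
  rw [LinearMap.pow_mulLeft, LinearMap.pow_mulLeft, ← not_exists, not_iff_not]
  constructor
  · intro h
    have : a ^ q ∈ LinearMap.range (LinearMap.mulLeft ℂ (a ^ q)) := ⟨1, by simp⟩
    rw [h] at this
    obtain ⟨c, hc⟩ := this
    exact ⟨c, by simpa using hc.symm⟩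
  · rintro ⟨c, hc⟩
    apply le_antisymm
    · rintro _ ⟨b, rfl⟩
      exact ⟨c * b, by simp [hc]⟩
    · rintro _ ⟨b, rfl⟩
      exact ⟨a * b, by simp [pow_succ]⟩

/-- Reconciles the two sign conventions: `a - λ` in the algebra, `λI - T` for operators. -/
theorem elementDescent_neg_eq_top_iff (a : A) :
    elementDescent (-a) = ⊤ ↔ elementDescent a = ⊤ := by
  have key : ∀ b : A, elementDescent b = ⊤ → elementDescent (-b) = ⊤ := by
    intro b hb
    rw [elementDescent_eq_top_iff] at hb ⊢
    intro q c h
    refine hb q (-c) ?_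
    rw [neg_pow, neg_pow b (q + 1), pow_succ, mul_assoc, mul_assoc] at h
    have h2 := congrArg (fun z => (-1 : A) ^ q * z) h
    simp only [← mul_assoc, ← pow_add, ← two_mul] at h2
    simpa [mul_assoc] using h2
  exact ⟨fun h => by simpa using key _ h, key a⟩

end Algebra

section Operator

variable {X : Type*} [NormedAddCommGroup X] [NormedSpace ℂ X]

theorem mem_elementDescentSpectrum_iff (T : X →L[ℂ] X) (l : ℂ) :
    l ∈ elementDescentSpectrum T ↔ elementDescent (shift T l) = ⊤ := by
  rw [← elementDescent_neg_eq_top_iff]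
  have : T - algebraMap ℂ (X →L[ℂ] X) l = -shift T l := by
    ext x
    simp [shift, Algebra.algebraMap_eq_smul_one]
  simp only [elementDescentSpectrum, Set.mem_ofPred_eq, this]

theorem descentSpectrum_subset (T : X →L[ℂ] X) :
    descentSpectrum T ⊆ elementDescentSpectrum T := by
  intro l hl
  rw [mem_elementDescentSpectrum_iff, elementDescent_eq_top_iff]
  intro q c hc
  refine (descent_eq_top_iff _).1 hl q ?_
  rw [← ContinuousLinearMap.toLinearMap_pow, ← ContinuousLinearMap.toLinearMap_pow]
  apply le_antisymm
  · rintro _ ⟨b, rfl⟩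
    exact ⟨c b, by simp [hc]⟩
  · rintro _ ⟨b, rfl⟩
    exact ⟨shift T l b, by simp [pow_succ]⟩

/-! ### Bounded lifting and the Drazin inverse -/

/-- A bounded operator whose range lies in the range of another one factors through it, with
control of norms. -/
theorem exists_bounded_preimage [CompleteSpace X] {P Q : X →L[ℂ] X}
    (h : LinearMap.range (P : X →ₗ[ℂ] X) ≤ LinearMap.range (Q : X →ₗ[ℂ] X)) :
    ∃ C > 0, ∀ x, ∃ w, Q w = P x ∧ ‖w‖ ≤ C * ‖x‖ := by
  -- The fibre product `{(x, w) | P x = Q w}` is closed, hence Banach. The open mapping theorem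
  -- applies to its projection onto `x`, so neither range need be closed.
  let D : X × X →L[ℂ] X := P.coprod (-Q)
  let Z : Submodule ℂ (X × X) := LinearMap.ker (D : X × X →ₗ[ℂ] X)
  have hZ : IsClosed (Z : Set (X × X)) := D.isClosed_ker
  have : CompleteSpace Z := hZ.completeSpace_coe
  let π : Z →L[ℂ] X := (ContinuousLinearMap.fst ℂ X X).comp Z.subtypeL
  have hπ : Function.Surjective π := by
    intro x
    obtain ⟨w, hw⟩ := h ⟨x, rfl⟩
    exact ⟨⟨(x, w), by simpa [Z, D, add_neg_eq_zero] using hw.symm⟩, rfl⟩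
  obtain ⟨C, hC, hlift⟩ := π.exists_preimage_norm_le hπ
  refine ⟨C, hC, fun x => ?_⟩
  obtain ⟨⟨⟨x', w⟩, hz⟩, rfl, hn⟩ := hlift x
  refine ⟨w, ?_, (norm_snd_le (x', w)).trans hn⟩
  have : P x' - Q w = 0 := by simpa [Z, D, sub_eq_add_neg] using hz
  exact (sub_eq_zero.1 this).symm

/-- Finite ascent and descent give a bounded Drazin inverse. -/
theorem exists_pow_eq_pow_succ_mul [CompleteSpace X] {S : X →L[ℂ] X} {p : ℕ}
    (hr : LinearMap.range ((S : X →ₗ[ℂ] X) ^ p) = LinearMap.range ((S : X →ₗ[ℂ] X) ^ (p + 1)))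
    (hk : LinearMap.ker ((S : X →ₗ[ℂ] X) ^ p) = LinearMap.ker ((S : X →ₗ[ℂ] X) ^ (p + 1))) :
    ∃ c : X →L[ℂ] X, S ^ p = S ^ (p + 1) * c := by
  -- The jump from `p` to `2p + 1` leaves room for `c = S^p F` with `S^(2p+1) F x = S^p x`. The lift
  -- `F` need not be linear, but `S^p F` is, since `S^p w` depends only on `S^(2p+1) w`.
  have hr' := range_pow_constant hr (p + 1)
  have hk' := Module.End.ker_pow_constant hk (p + 1)
  rw [← ContinuousLinearMap.toLinearMap_pow, ← ContinuousLinearMap.toLinearMap_pow] at hr' hk'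
  obtain ⟨C, hC, hF⟩ := exists_bounded_preimage hr'.le
  choose F hF hFn using hF
  have inj : ∀ u v, (S ^ (p + (p + 1))) u = (S ^ (p + (p + 1))) v → (S ^ p) u = (S ^ p) v := by
    intro u v huv
    have : u - v ∈ LinearMap.ker ((S ^ p : X →L[ℂ] X) : X →ₗ[ℂ] X) := by
      rw [hk', LinearMap.mem_ker, map_sub]
      exact sub_eq_zero.2 huv
    rw [LinearMap.mem_ker, map_sub] at this
    exact sub_eq_zero.1 this
  let c : X →ₗ[ℂ] X :=
    { toFun := fun x => (S ^ p) (F x)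
      map_add' := fun x y => by
        rw [← map_add]
        apply inj
        rw [map_add]
        simp only [hF, map_add]
      map_smul' := fun a x => by
        rw [← map_smul]
        apply inj
        rw [map_smul]
        simp only [hF, map_smul, RingHom.id_apply] }
  refine ⟨c.mkContinuous (‖S ^ p‖ * C) fun x => ?_, ?_⟩
  · calc ‖(S ^ p) (F x)‖ ≤ ‖S ^ p‖ * ‖F x‖ := (S ^ p).le_opNorm _
      _ ≤ ‖S ^ p‖ * (C * ‖x‖) := by gcongr; exact hFn x
      _ = _ := by ring
  · ext x
    change (S ^ p) x = (S ^ (p + 1)) ((S ^ p) (F x))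
    rw [← hF x, add_comm, pow_add S (p + 1) p, mul_apply_eq_comp]

/-! ### Power series at a point of finite descent -/

theorem exists_geometric_sequence {P Q : X →L[ℂ] X} {C : ℝ} (hC : 0 ≤ C)
    (h : ∀ x, ∃ w, Q w = P x ∧ ‖w‖ ≤ C * ‖x‖) (x : X) :
    ∃ u : ℕ → X, u 0 = x ∧ (∀ n, Q (u (n + 1)) = P (u n)) ∧ ∀ n, ‖u n‖ ≤ C ^ n * ‖x‖ := by
  choose F hF hFn using h
  refine ⟨fun n => F^[n] x, rfl, fun n => ?_, fun n => ?_⟩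
  · simp [Function.iterate_succ_apply', hF]
  · induction n with
    | zero => simp
    | succ n ih =>
      simp only [Function.iterate_succ_apply']
      calc _ ≤ C * ‖F^[n] x‖ := hFn _
        _ ≤ C * (C ^ n * ‖x‖) := by gcongr
        _ = _ := by ring

theorem norm_pow_smul_le {C : ℝ} (hC : 0 < C) {y : X} {n : ℕ} {B : ℝ} (hy : ‖y‖ ≤ C ^ n * B)
    {μ : ℂ} (hμ : ‖μ‖ ≤ (2 * C)⁻¹) : ‖μ ^ n • y‖ ≤ (1 / 2) ^ n * B := by
  rw [norm_smul, norm_pow]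
  calc ‖μ‖ ^ n * ‖y‖ ≤ (2 * C)⁻¹ ^ n * (C ^ n * B) := by gcongr
    _ = _ := by rw [← mul_assoc, ← mul_pow]; congr 2; field_simp

theorem summable_pow_smul [CompleteSpace X] {C B : ℝ} (hC : 0 < C) {y : ℕ → X}
    (hy : ∀ n, ‖y n‖ ≤ C ^ n * B) {μ : ℂ} (hμ : ‖μ‖ ≤ (2 * C)⁻¹) :
    Summable fun n => μ ^ n • y n :=
  Summable.of_norm_bounded (summable_geometric_two.mul_right B)
    fun n => norm_pow_smul_le hC (hy n) hμ

/-- `S - μ` divides `S^q - μ^q`, which acts on `N(S^q)` as the invertible scalar `-μ^q`. -/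
theorem pow_apply_mem_range_sub_smul {S : X →L[ℂ] X} {q : ℕ} {μ : ℂ} (hμ : μ ≠ 0) {z : X}
    (hz : (S ^ q) z = 0) : ∃ v, S v - μ • v = z := by
  have hcomm : Commute S (algebraMap ℂ (X →L[ℂ] X) μ) := Algebra.commutes' μ S |>.symm
  obtain ⟨R, hR⟩ := hcomm.sub_dvd_pow_sub_pow q
  have := DFunLike.congr_fun hR z
  rw [← map_pow] at this
  simp only [Algebra.algebraMap_eq_smul_one, sub_apply, hz,
    mul_apply_eq_comp, smul_apply,
    one_apply_eq_self, zero_sub] at this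
  refine ⟨-(μ ^ q)⁻¹ • R z, ?_⟩
  rw [map_smul, smul_comm μ, ← smul_sub, ← this, smul_neg, neg_smul, neg_neg,
    inv_smul_smul₀ (pow_ne_zero q hμ)]

/-- Small nonzero translates of an operator of finite descent are surjective. -/
theorem exists_surjective_sub_smul [CompleteSpace X] {S : X →L[ℂ] X} {q : ℕ}
    (hr : LinearMap.range ((S : X →ₗ[ℂ] X) ^ q) = LinearMap.range ((S : X →ₗ[ℂ] X) ^ (q + 1))) :
    ∃ r > 0, ∀ μ : ℂ, μ ≠ 0 → ‖μ‖ < r → ∀ y, ∃ v, S v - μ • v = y := by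
  rw [← ContinuousLinearMap.toLinearMap_pow, ← ContinuousLinearMap.toLinearMap_pow] at hr
  obtain ⟨C, hC, hF⟩ := exists_bounded_preimage hr.le
  refine ⟨(2 * C)⁻¹, by positivity, fun μ hμ0 hμ y => ?_⟩
  obtain ⟨u, hu0, hu, hun⟩ := exists_geometric_sequence hC.le hF y
  have hs : Summable fun n => μ ^ n • u (n + 1) :=
    summable_pow_smul (B := C * ‖y‖) hC (fun n => (hun (n + 1)).trans_eq (by ring)) hμ.le
  have hs' : Summable fun n => μ ^ n • u n := summable_pow_smul hC hun hμ.le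
  -- Since `S^(q+1) u_(n+1) = S^q u_n`, this `w` solves `(S - μ) w = y` modulo `N(S^q)`. The error
  -- is corrected by `pow_apply_mem_range_sub_smul`, which needs `μ ≠ 0`.
  set w := ∑' n, μ ^ n • u (n + 1) with hw
  have h1 : (S ^ q) (S w) = (S ^ q) (∑' n, μ ^ n • u n) := by
    rw [← mul_apply_eq_comp, ← pow_succ, hw, ContinuousLinearMap.map_tsum _ hs,
      ContinuousLinearMap.map_tsum _ hs']
    simp [hu]
  have h2 : ∑' n, μ ^ n • u n = y + μ • w := by
    rw [hs'.tsum_eq_zero_add, hw, ← hs.tsum_const_smul]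
    simp [hu0, pow_succ', mul_smul]
  have h3 : (S ^ q) (y - (S w - μ • w)) = 0 := by
    rw [map_sub, map_sub, h1, h2, map_add]
    abel
  obtain ⟨v, hv⟩ := pow_apply_mem_range_sub_smul hμ0 h3
  refine ⟨v + w, ?_⟩
  rw [map_add, smul_add, add_sub_add_comm, hv]
  abel

/-- An operator of finite descent and infinite ascent has an analytic family of eigenvectors. -/
theorem exists_analytic_eigenvectors [CompleteSpace X] {S : X →L[ℂ] X} {q : ℕ}
    (hr : LinearMap.range ((S : X →ₗ[ℂ] X) ^ q) = LinearMap.range ((S : X →ₗ[ℂ] X) ^ (q + 1)))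
    (ha : ascent (S : X →ₗ[ℂ] X) = ⊤) :
    ∃ r > 0, ∃ f : ℂ → X, AnalyticOnNhd ℂ f (Metric.ball 0 r) ∧
      (∀ μ ∈ Metric.ball (0 : ℂ) r, S (f μ) = μ • f μ) ∧ f 0 ≠ 0 := by
  have hk := (ascent_eq_top_iff _).1 ha q
  rw [← ContinuousLinearMap.toLinearMap_pow, ← ContinuousLinearMap.toLinearMap_pow] at hr hk
  obtain ⟨C, hC, hF⟩ := exists_bounded_preimage hr.le
  obtain ⟨x, hx1, hx0⟩ : ∃ x, (S ^ (q + 1)) x = 0 ∧ (S ^ q) x ≠ 0 := by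
    by_contra! hcon
    refine hk (le_antisymm (fun x hx => ?_) fun x hx => ?_)
    · have hx' : (S ^ q) x = 0 := hx
      rw [LinearMap.mem_ker, ContinuousLinearMap.coe_coe, pow_succ', mul_apply_eq_comp, hx', map_zero]
    · exact hcon x hx
  obtain ⟨u, hu0, hu, hun⟩ := exists_geometric_sequence hC.le hF x
  have hy : ∀ n, ‖(S ^ q) (u n)‖ ≤ C ^ n * (‖S ^ q‖ * ‖x‖) := fun n =>
    ((S ^ q).le_opNorm_of_le (hun n)).trans_eq (by ring)
  have hs : ∀ μ ∈ Metric.ball (0 : ℂ) (2 * C)⁻¹, Summable fun n => μ ^ n • (S ^ q) (u n) :=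
    fun μ hμ => summable_pow_smul hC hy (mem_ball_zero_iff.1 hμ).le
  refine ⟨(2 * C)⁻¹, by positivity, fun μ => ∑' n, μ ^ n • (S ^ q) (u n), ?_, ?_, ?_⟩
  · refine DifferentiableOn.analyticOnNhd ?_ Metric.isOpen_ball
    refine Complex.differentiableOn_tsum_of_summable_norm
      (summable_geometric_two.mul_right (‖S ^ q‖ * ‖x‖)) (fun n => by fun_prop)
      Metric.isOpen_ball fun n μ hμ => norm_pow_smul_le hC (hy n) (mem_ball_zero_iff.1 hμ).le
  · intro μ hμ
    -- `S` kills the term `n = 0` because `S^(q+1) x = 0`, and sends each later term to `μ` times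
    -- its predecessor.
    have hS : ∀ n, S (μ ^ n • (S ^ q) (u n)) = μ ^ n • (S ^ (q + 1)) (u n) := fun n => by
      rw [map_smul, pow_succ', mul_apply_eq_comp]
    have hs2 : Summable fun n => μ ^ n • (S ^ (q + 1)) (u n) := by
      simpa only [hS] using S.summable (hs μ hμ)
    rw [ContinuousLinearMap.map_tsum _ (hs μ hμ), ← (hs μ hμ).tsum_const_smul]
    simp only [hS]
    rw [hs2.tsum_eq_zero_add]
    simp only [hu0, hx1, hu, pow_succ' μ, mul_smul, smul_zero, zero_add]
  · simp only
    rw [tsum_eq_single 0 fun n hn => by simp [hn]]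
    simpa [hu0] using hx0

/-! ### Finite descent of `λI - T` -/

theorem shift_apply (T : X →L[ℂ] X) (l : ℂ) (x : X) : shift T l x = l • x - T x := rfl

theorem descentSpectrum_eq_of_ascent_ne_top [CompleteSpace X] {T : X →L[ℂ] X}
    (h : ∀ l ∉ descentSpectrum T, ascent (shift T l : X →ₗ[ℂ] X) ≠ ⊤) :
    descentSpectrum T = elementDescentSpectrum T := by
  refine (descentSpectrum_subset T).antisymm fun l hl => ?_
  by_contra hld
  have ha := h l hld
  have hd : descent (shift T l : X →ₗ[ℂ] X) ≠ ⊤ := hld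
  rw [Ne, ascent_eq_top_iff] at ha
  rw [Ne, descent_eq_top_iff] at hd
  push Not at ha hd
  obtain ⟨p, hp⟩ := ha
  obtain ⟨q, hq⟩ := hd
  have hk : LinearMap.ker ((shift T l : X →ₗ[ℂ] X) ^ (p + q)) =
      LinearMap.ker ((shift T l : X →ₗ[ℂ] X) ^ (p + q + 1)) :=
    (Module.End.ker_pow_constant hp q).symm.trans (Module.End.ker_pow_constant hp (q + 1))
  have hr : LinearMap.range ((shift T l : X →ₗ[ℂ] X) ^ (p + q)) =
      LinearMap.range ((shift T l : X →ₗ[ℂ] X) ^ (p + q + 1)) := by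
    rw [add_comm p q]
    exact (range_pow_constant hq p).symm.trans (range_pow_constant hq (p + 1))
  obtain ⟨c, hc⟩ := exists_pow_eq_pow_succ_mul hr hk
  exact (elementDescent_eq_top_iff _).1 ((mem_elementDescentSpectrum_iff T l).1 hl) _ c hc

/-- At a point of finite descent and infinite ascent the SVEP fails, and all nearby translates are
surjective but not injective. -/
theorem exists_open_surjective_not_injective [CompleteSpace X] {T : X →L[ℂ] X} {l : ℂ}
    (hd : l ∉ descentSpectrum T) (ha : ascent (shift T l : X →ₗ[ℂ] X) = ⊤) :
    l ∈ svepFailureSet T ∧ ∃ U : Set ℂ, IsOpen U ∧ U.Nonempty ∧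
      ∀ m ∈ U, Function.Surjective (shift T m) ∧ ∃ x, x ≠ 0 ∧ shift T m x = 0 := by
  have hd' : descent (shift T l : X →ₗ[ℂ] X) ≠ ⊤ := hd
  rw [Ne, descent_eq_top_iff] at hd'
  push Not at hd'
  obtain ⟨q, hq⟩ := hd'
  obtain ⟨r, hr, f, hfa, hf, hf0⟩ := exists_analytic_eigenvectors hq ha
  obtain ⟨s, hs, hsurj⟩ := exists_surjective_sub_smul hq
  have hshift : ∀ μ x, shift T (l - μ) x = shift T l x - μ • x := fun μ x => by
    simp only [shift_apply, sub_smul]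
    abel
  have hball : ∀ {m : ℂ} {t : ℝ}, m ∈ Metric.ball l t → l - m ∈ Metric.ball (0 : ℂ) t :=
    fun {m t} hm => by rwa [mem_ball_zero_iff, ← dist_eq_norm, dist_comm]
  have hsol : ∀ m ∈ Metric.ball l r, shift T m (f (l - m)) = 0 := fun m hm => by
    have := hshift (l - m) (f (l - m))
    rwa [sub_sub_cancel, hf _ (hball hm), sub_self] at this
  refine ⟨fun hsvep => hf0 ?_, ?_⟩
  · have hl := Metric.mem_ball_self (x := l) hr
    have := hsvep (Metric.ball l r) Metric.isOpen_ball
      ((convex_ball l r).isConnected ⟨l, hl⟩) hl (fun m => f (l - m))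
      (fun m hm => (hfa _ (hball hm)).comp (by fun_prop)) hsol l hl
    simpa using this
  · have hcont : ContinuousAt f 0 := (hfa 0 (Metric.mem_ball_self hr)).continuousAt
    obtain ⟨t, ht, htf⟩ := Metric.eventually_nhds_iff_ball.1 (hcont.eventually_ne hf0)
    -- The radii secure, in turn, the eigenvector equation, surjectivity and `f ≠ 0`. The centre is
    -- removed because surjectivity is known only for `μ ≠ 0`.
    set ε := min r (min s t) with hε
    have hε0 : 0 < ε := by positivity
    refine ⟨Metric.ball l ε ∩ {l}ᶜ, Metric.isOpen_ball.inter isOpen_compl_singleton,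
      ⟨l + (ε / 2 : ℝ), ?_, ?_⟩, ?_⟩
    · rw [Metric.mem_ball, dist_self_add_left, Complex.norm_real, Real.norm_eq_abs,
        abs_of_pos (by positivity)]
      linarith
    · simpa using hε0.ne'
    · rintro m ⟨hm, hml⟩
      have hmr := Metric.ball_subset_ball (min_le_left r (min s t)) hm
      have hms := Metric.ball_subset_ball ((min_le_right r _).trans (min_le_left s t)) hm
      have hmt := Metric.ball_subset_ball ((min_le_right r _).trans (min_le_right s t)) hm
      refine ⟨fun y => ?_, f (l - m), htf _ (hball hmt), hsol m hmr⟩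
      obtain ⟨v, hv⟩ := hsurj (l - m) (sub_ne_zero.2 fun h => hml h.symm)
        (mem_ball_zero_iff.1 (hball hms)) y
      refine ⟨v, ?_⟩
      rw [← hv, ← hshift, sub_sub_cancel]

/-! ### Membership in the various spectra -/

theorem mem_spectrum_iff_not_isUnit_shift {T : X →L[ℂ] X} {m : ℂ} :
    m ∈ spectrum ℂ T ↔ ¬ IsUnit (shift T m) := by
  rw [spectrum.mem_iff, Algebra.algebraMap_eq_smul_one]
  rfl

theorem mem_spectrum_of_shift_apply_eq_zero {T : X →L[ℂ] X} {m : ℂ} {x : X} (hx : x ≠ 0)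
    (h : shift T m x = 0) : m ∈ spectrum ℂ T := by
  rw [mem_spectrum_iff_not_isUnit_shift]
  rintro ⟨u, hu⟩
  apply hx
  have := DFunLike.congr_fun u.inv_mul x
  rwa [mul_apply_eq_comp, hu, h, map_zero, one_apply_eq_self, eq_comm] at this

theorem mem_pointSpectrum_of_shift_apply_eq_zero {T : X →L[ℂ] X} {m : ℂ} {x : X} (hx : x ≠ 0)
    (h : shift T m x = 0) : m ∈ pointSpectrum T :=
  Module.End.hasEigenvalue_of_hasEigenvector
    ⟨Module.End.mem_eigenspace_iff.2 (sub_eq_zero.1 h).symm, hx⟩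

theorem mem_approximatePointSpectrum_of_shift_apply_eq_zero {T : X →L[ℂ] X} {m : ℂ} {x : X}
    (hx : x ≠ 0) (h : shift T m x = 0) : m ∈ approximatePointSpectrum T := by
  refine ⟨fun _ => ((‖x‖⁻¹ : ℝ) : ℂ) • x, fun _ => ?_, ?_⟩
  · rw [norm_smul, Complex.norm_real, norm_inv, norm_norm, inv_mul_cancel₀ (norm_ne_zero_iff.2 hx)]
  · simp only [map_smul, h, smul_zero]
    exact tendsto_const_nhds

/-- The deficiency vanishes, so the index equals the nullity, which is positive. -/
theorem not_isUpperSemiWeyl_of_surjective {S : X →L[ℂ] X} (hs : Function.Surjective S) {x : X}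
    (hx : x ≠ 0) (h : S x = 0) : ¬ IsUpperSemiWeyl S := by
  rintro ⟨-, hi⟩
  have hβ : deficiency S = 0 := by
    rw [deficiency, LinearMap.range_eq_top.2 hs, Cardinal.toENat_eq_zero]
    exact rank_subsingleton' ℂ _
  have hα : nullity S ≠ 0 := by
    rw [nullity, Ne, Cardinal.toENat_eq_zero, rank_zero_iff]
    intro hsub
    exact hx (congrArg Subtype.val
      (Subsingleton.elim (⟨x, h⟩ : LinearMap.ker (S : X →ₗ[ℂ] X)) 0))
  rw [index, hβ] at hi
  simp only [ENat.toENNReal_zero, EReal.coe_ennreal_zero, sub_zero] at hi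
  have h0 : ((nullity S : ENNReal) : EReal) = 0 := le_antisymm hi (EReal.coe_ennreal_nonneg _)
  rw [EReal.coe_ennreal_eq_zero] at h0
  exact hα (by exact_mod_cast h0)

end Operator

end DescentSpectrum

theorem corollary1 {X : Type*} [NormedAddCommGroup X] [NormedSpace ℂ X] [CompleteSpace X]
    (T : X →L[ℂ] X)
    (h : spectrum ℂ T = DescentSpectrum.surjectivitySpectrum T ∨
      interior (DescentSpectrum.approximatePointSpectrum T) = ∅ ∨
      interior (DescentSpectrum.pointSpectrum T) = ∅ ∨
      interior (DescentSpectrum.ascentSpectrum T) = ∅ ∨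
      interior (DescentSpectrum.upperSemiBrowderSpectrum T) = ∅ ∨
      interior (DescentSpectrum.upperSemiWeylSpectrum T) = ∅ ∨
      DescentSpectrum.HasSVEP T) :
    DescentSpectrum.descentSpectrum T = DescentSpectrum.elementDescentSpectrum T := by
  refine DescentSpectrum.descentSpectrum_eq_of_ascent_ne_top fun l hd ha => ?_
  obtain ⟨hl, U, hU, ⟨m, hm⟩, hUT⟩ := DescentSpectrum.exists_open_surjective_not_injective hd ha
  -- Conditions 2 to 6 fail because the nonempty open `U` lies inside the spectrum in question.
  have key : ∀ {Z : Set ℂ}, interior Z = ∅ → ¬ U ⊆ Z := fun hZ hUZ => by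
    have := interior_maximal hUZ hU hm
    rwa [hZ] at this
  have hasc : U ⊆ DescentSpectrum.ascentSpectrum T := fun μ hμ => by
    obtain ⟨hs, x, hx, hTx⟩ := hUT μ hμ
    exact DescentSpectrum.ascent_eq_top_of_surjective hs hx hTx
  rcases h with h | h | h | h | h | h | h
  · obtain ⟨hs, x, hx, hTx⟩ := hUT m hm
    have := DescentSpectrum.mem_spectrum_of_shift_apply_eq_zero hx hTx
    rw [h] at this
    exact this hs
  · refine key h fun μ hμ => ?_
    obtain ⟨-, x, hx, hTx⟩ := hUT μ hμ
    exact DescentSpectrum.mem_approximatePointSpectrum_of_shift_apply_eq_zero hx hTx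
  · refine key h fun μ hμ => ?_
    obtain ⟨-, x, hx, hTx⟩ := hUT μ hμ
    exact DescentSpectrum.mem_pointSpectrum_of_shift_apply_eq_zero hx hTx
  · exact key h hasc
  · exact key h fun μ hμ hB => hB.2.ne (hasc hμ)
  · refine key h fun μ hμ => ?_
    obtain ⟨hs, x, hx, hTx⟩ := hUT μ hμ
    exact DescentSpectrum.not_isUpperSemiWeyl_of_surjective hs hx hTx
  · rw [h] at hl
    exact hl
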